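/- Let $E$ and $F$ be real Banach spaces, let $X$ and $Y$ be smooth ($C^\infty$) Banach manifolds without boundary modelled on $E$ and $F$ respectively (no separability or second countability is assumed), and let $\Phi : X \to Y$ be a smooth map such that * $\Phi$ is Fredholm, that is, for every $x \in X$ the differential $D\Phi(x) : T_xX \to T_{\Phi(x)}Y$ is a Fredholm operator (it has finite-dimensional kernel and closed range of finite codimension); and * $\Phi$ is paraproper, that is, there exists a sequence $(X_m)_{m\in\mathbb{N}}$ of closed subsets of $X$ with $X = \bigcup_{m} X_m$ such that, for every $m$, the restriction $\Phi|_{X_m} : X_m \to Y$ is proper (a continuous closed map with compact fibres; for Hausdorff $Y$ this means equivalently that preimages of compact sets are compact). Call $y \in Y$ a regular value of $\Phi$ if $D\Phi(x)$ is surjective for every $x \in \Phi^{-1}(y)$. Then the set of regular values of $\Phi$ is generic in $Y$, that is, it contains a countable intersection of dense open subsets of $Y$. -/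

import Mathlib

open scoped Manifold ContDiff

/-- A continuous map is paraproper if its domain is a countable union of closed sets
on each of which the map restricts to a proper map. -/
structure IsParaproper {X Y : Type*} [TopologicalSpace X] [TopologicalSpace Y]
    (Φ : X → Y) : Prop where
  continuous : Continuous Φ
  exists_exhaustion : ∃ K : ℕ → Set X, (⋃ m, K m) = Set.univ ∧
    ∀ m, IsClosed (K m) ∧ IsProperMap ((K m).domRestrict Φ)

section BanachManifold

variable (E F : Type*) [NormedAddCommGroup E] [NormedSpace ℝ E]
  [NormedAddCommGroup F] [NormedSpace ℝ F]
  {X Y : Type*} [TopologicalSpace X] [ChartedSpace E X]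
  [TopologicalSpace Y] [ChartedSpace F Y]

/-- A smooth Fredholm map between manifolds modelled on `E` and `F`: a smooth map whose
differential at every point is a Fredholm operator (of any index). -/
structure IsSmoothFredholmMap (Φ : X → Y) : Prop where
  contMDiff : ContMDiff 𝓘(ℝ, E) 𝓘(ℝ, F) ∞ Φ
  isFredholm_mfderiv : ∀ x : X, (mfderiv 𝓘(ℝ, E) 𝓘(ℝ, F) Φ x).IsFredholm

/-- The regular values of `Φ`: the points `y` such that the differential of `Φ` is surjective at
every point of the fibre over `y`. In particular, points outside the image are regular values. -/
def regularValues (Φ : X → Y) : Set Y :=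
  {y | ∀ x : X, Φ x = y → Function.Surjective (mfderiv 𝓘(ℝ, E) 𝓘(ℝ, F) Φ x)}

end BanachManifold

/-! The argument is Smale's: critical values are nowhere dense locally, and paraproperness makes
them meagre globally.

Near a point with derivative `T`, let `π` project `F` onto the closed range of `T`; its kernel is
finite-dimensional. Then `π ∘ Φ` is a submersion there with kernel `ker T`, so in a chart with
values in `range T × ker T` it is the first coordinate (`exists_straightening`). Along each
translate of `ker π`, critical values of `Φ` are critical values of a map from `ker T` to `ker π`
(`exists_slice_criticalValues`), a null set by Morse–Sard; hence the local critical image has no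
interior. It is closed because balls of `ker T` are compact (`exists_nhds_isClosed_criticalValues`).

On a set where `Φ` is proper, compactness of fibres and closedness of the map reduce matters, near
each value, to finitely many such neighbourhoods (`IsProperMap.isNowhereDense_image_inter`).
Countability enters only through the exhaustion.

Morse–Sard itself is obtained from a Hausdorff dimension estimate for scalar functions, then by
slicing and Fubini. -/

open Set Filter Topology MeasureTheory Module

/-! ### Local normal form of submersions and Lyapunov–Schmidt reduction. -/

section Straightening

variable {E R F : Type*} [NormedAddCommGroup E] [NormedSpace ℝ E]
  [NormedAddCommGroup R] [NormedSpace ℝ R]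
  [NormedAddCommGroup F] [NormedSpace ℝ F]

/-- A smooth submersion with split kernel is, in suitable smooth local coordinates, a projection. -/
theorem exists_straightening [CompleteSpace E] [CompleteSpace R] {W : E → R} {x₀ : E}
    (hW : ∀ᶠ x in 𝓝 x₀, ContDiffAt ℝ ∞ W x)
    (hsurj : (fderiv ℝ W x₀).range = ⊤) (hker : (fderiv ℝ W x₀).ker.ClosedComplemented) :
    ∃ ψ : OpenPartialHomeomorph E (R × (fderiv ℝ W x₀).ker), x₀ ∈ ψ.source ∧
      (∀ x, (ψ x).1 = W x) ∧ (∀ x ∈ ψ.source, ContDiffAt ℝ ∞ ψ x) ∧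
      ∀ z ∈ ψ.target, ContDiffAt ℝ ∞ ψ.symm z := by
  have hst : HasStrictFDerivAt W (fderiv ℝ W x₀) x₀ :=
    hW.self_of_nhds.hasStrictFDerivAt (by simp)
  set ψ := hst.implicitToOpenPartialHomeomorphOfComplemented W _ hsurj hker
  have hψf : (ψ : E → _) = fun x ↦ (W x, Classical.choose hker (x - x₀)) := rfl
  have hsm : ∀ᶠ x in 𝓝 x₀, ContDiffAt ℝ ∞ ψ x := by
    filter_upwards [hW] with x hx
    rw [hψf]
    exact hx.prodMk ((Classical.choose hker).contDiff.comp
      (contDiff_id.sub contDiff_const)).contDiffAt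
  have hinv0 : fderiv ℝ ψ x₀ ∈
      range ((↑) : (E ≃L[ℝ] R × (fderiv ℝ W x₀).ker) → E →L[ℝ] R × (fderiv ℝ W x₀).ker) :=
    (hst.implicitFunctionDataOfComplemented W _ hsurj hker).isInvertible_fderiv_prodFun
  -- Invertibility is an open condition; shrinking the source to where it holds makes the inverse
  -- smooth on the whole target.
  have hinv : ∀ᶠ x in 𝓝 x₀, fderiv ℝ ψ x ∈
      range ((↑) : (E ≃L[ℝ] R × (fderiv ℝ W x₀).ker) → E →L[ℝ] R × (fderiv ℝ W x₀).ker) := by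
    have hc : ContinuousAt (fderiv ℝ ψ) x₀ := hsm.self_of_nhds.continuousAt_fderiv (by simp)
    exact hc.eventually (ContinuousLinearEquiv.isOpen.mem_nhds hinv0)
  obtain ⟨S, hS, hSo, hxS⟩ := eventually_nhds_iff.1 (hsm.and hinv)
  refine ⟨ψ.restrOpen S hSo, ⟨hst.mem_implicitToOpenPartialHomeomorphOfComplemented_source hsurj
    hker, hxS⟩, fun x ↦ rfl, fun x hx ↦ (hS x hx.2).1, fun z hz ↦ ?_⟩
  have hmem := (ψ.restrOpen S hSo).map_target hz
  obtain ⟨e, he⟩ := (hS _ hmem.2).2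
  refine (ψ.restrOpen S hSo).contDiffAt_symm (f₀' := e) hz ?_ (hS _ hmem.2).1
  rw [he]
  exact ((hS _ hmem.2).1.differentiableAt (by simp)).hasFDerivAt

/-- Lyapunov–Schmidt reduction: if `π ∘ Φ` is the first component of a smooth chart `ψ`, then
along each translate of `ker π` the critical values of `Φ` are critical values of a smooth map from
the second factor of the chart to `ker π`. -/
theorem exists_slice_criticalValues {K : Type*} [NormedAddCommGroup K] [NormedSpace ℝ K]
    {Φ : E → F} (π : F →L[ℝ] R) (hπ : π.ker.ClosedComplemented)
    (ψ : OpenPartialHomeomorph E (R × K)) (hfst : ∀ x, (ψ x).1 = π (Φ x))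
    (hΦ : ∀ x ∈ ψ.source, ContDiffAt ℝ ∞ Φ x)
    (hψs : ∀ z ∈ ψ.target, ContDiffAt ℝ ∞ ψ.symm z) {C : Set E} (hCs : C ⊆ ψ.source)
    (hC : ∀ x ∈ C, ¬ Function.Surjective (fderiv ℝ Φ x)) (y : F) :
    ∃ (g : K → π.ker) (B : Set K), (∀ k ∈ B, ∀ᶠ k' in 𝓝 k, ContDiffAt ℝ ∞ g k') ∧
      (∀ k ∈ B, ¬ Function.Surjective (fderiv ℝ g k)) ∧
      {n : π.ker | y + n ∈ Φ '' C} ⊆ g '' B := by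
  obtain ⟨P, hP⟩ := hπ
  set G : R × K → F := fun z ↦ Φ (ψ.symm z) with hG
  have hGsm : ∀ z ∈ ψ.target, ContDiffAt ℝ ∞ G z := fun z hz ↦
    (hΦ _ (ψ.map_target hz)).comp z (hψs z hz)
  have hπG : ∀ z ∈ ψ.target, π (G z) = z.1 := fun z hz ↦ by
    rw [hG, ← hfst, ψ.right_inv hz]
  have hline : Continuous fun k : K ↦ (π y, k) := by fun_prop
  -- Since `π (G z) = z.1`, the points sent into `y + ker π` have first coordinate `π y`, and `G (π
  -- y, k) - y` already lies in `ker π`; `P` only makes this part of the type.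
  refine ⟨fun k ↦ P (G (π y, k) - y), {k | (π y, k) ∈ ψ.target ∧ ψ.symm (π y, k) ∈ C}, ?_, ?_, ?_⟩
  · rintro k ⟨hk, -⟩
    filter_upwards [hline.continuousAt.eventually (ψ.open_target.mem_nhds hk)] with k' hk'
    exact P.contDiff.contDiffAt.comp k' (((hGsm _ hk').comp k'
      (contDiff_prodMk_right (π y)).contDiffAt).sub contDiffAt_const)
  · rintro k ⟨hk, hkC⟩ hsurj
    refine hC _ hkC ?_
    have hGd : HasFDerivAt G (fderiv ℝ G (π y, k)) (π y, k) :=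
      ((hGsm _ hk).differentiableAt (by simp)).hasFDerivAt
    have hgd : HasFDerivAt (fun k ↦ P (G (π y, k) - y))
        (P.comp ((fderiv ℝ G (π y, k)).comp (ContinuousLinearMap.inr ℝ R K))) k :=
      P.hasFDerivAt.comp k ((hGd.comp k (hasFDerivAt_prodMk_right (π y) k)).sub_const y)
    rw [hgd.fderiv] at hsurj
    -- The derivative of `G` is block triangular with an identity block on `R`, so it is onto as
    -- soon as its restriction to `K` is onto `ker π`.
    have hπd : π.comp (fderiv ℝ G (π y, k)) = ContinuousLinearMap.fst ℝ R K := by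
      have h1 : HasFDerivAt (fun z ↦ π (G z)) (π.comp (fderiv ℝ G (π y, k))) (π y, k) :=
        π.hasFDerivAt.comp _ hGd
      have h2 : HasFDerivAt (fun z ↦ π (G z)) (ContinuousLinearMap.fst ℝ R K) (π y, k) :=
        hasFDerivAt_fst.congr_of_eventuallyEq
          (eventually_of_mem (ψ.open_target.mem_nhds hk) hπG)
      exact h1.unique h2
    have hπd' : ∀ z, π (fderiv ℝ G (π y, k) z) = z.1 := fun z ↦ DFunLike.congr_fun hπd z
    have hcomp : fderiv ℝ G (π y, k) =
        (fderiv ℝ Φ (ψ.symm (π y, k))).comp (fderiv ℝ ψ.symm (π y, k)) :=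
      (((hΦ _ (ψ.map_target hk)).differentiableAt (by simp)).hasFDerivAt.comp _
        ((hψs _ hk).differentiableAt (by simp)).hasFDerivAt).fderiv
    intro z
    have hw : z - fderiv ℝ G (π y, k) (π z, 0) ∈ π.ker := by
      simp [hπd']
    obtain ⟨κ, hκ⟩ := hsurj ⟨_, hw⟩
    have hκN : fderiv ℝ G (π y, k) (0, κ) ∈ π.ker := by simp [hπd']
    have hκ' : fderiv ℝ G (π y, k) (0, κ) = z - fderiv ℝ G (π y, k) (π z, 0) := by
      have := hP ⟨_, hκN⟩
      simp only [ContinuousLinearMap.comp_apply, ContinuousLinearMap.inr_apply] at hκ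
      rw [hκ] at this
      exact (congrArg Subtype.val this).symm
    refine ⟨fderiv ℝ ψ.symm (π y, k) (π z, κ), ?_⟩
    rw [← ContinuousLinearMap.comp_apply, ← hcomp,
      show ((π z, κ) : R × K) = (0, κ) + (π z, 0) by simp, map_add, hκ', sub_add_cancel]
  · rintro n ⟨x, hx, hxn⟩
    have hn : π n = 0 := n.2
    have h1 : (ψ x).1 = π y := by rw [hfst, hxn, map_add, hn, add_zero]
    have h2 : ψ x = (π y, (ψ x).2) := by rw [← h1]
    refine ⟨(ψ x).2, ⟨?_, ?_⟩, ?_⟩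
    · rw [← h2]; exact ψ.map_source (hCs hx)
    · rw [← h2, ψ.left_inv (hCs hx)]; exact hx
    · simp only [hG]
      rw [← h2, ψ.left_inv (hCs hx), hxn, add_sub_cancel_left, hP]

end Straightening

/-! ### Morse–Sard for real-valued functions. -/

section ScalarSard

universe u

/-- Taylor estimate: a function whose derivatives of order `< k` vanish at `x` is
bounded by the supremum of its `k`-th derivative times `‖y - x‖ ^ k`. -/
theorem norm_le_mul_pow_of_iteratedFDeriv_eq_zero {E : Type u} [NormedAddCommGroup E]
    [NormedSpace ℝ E] (k : ℕ) {V : Type u} [NormedAddCommGroup V] [NormedSpace ℝ V] {G : E → V}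
    {s : Set E} (hs : Convex ℝ s) {M : ℝ} (hG : ∀ z ∈ s, ContDiffAt ℝ k G z)
    (hM : ∀ z ∈ s, ‖iteratedFDeriv ℝ k G z‖ ≤ M) {x : E} (hx : x ∈ s)
    (h0 : ∀ i < k, iteratedFDeriv ℝ i G x = 0) {y : E} (hy : y ∈ s) :
    ‖G y‖ ≤ M * ‖y - x‖ ^ k := by
  -- The inductive step replaces `V` by `E →L[ℝ] V`, which is why both spaces share a universe.
  induction k generalizing V y with
  | zero => simpa using hM y hy
  | succ k ih =>
    have hd : ∀ z ∈ s, ‖fderiv ℝ G z‖ ≤ M * ‖z - x‖ ^ k := by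
      intro z hz
      refine ih (fun z hz ↦ (hG z hz).fderiv_right (by norm_cast)) (fun z hz ↦ ?_)
        (fun i hi ↦ ?_) hz
      · rw [norm_iteratedFDeriv_fderiv]; exact hM z hz
      · rw [← norm_eq_zero, norm_iteratedFDeriv_fderiv, h0 _ (by omega), norm_zero]
    have hM0 : 0 ≤ M := (norm_nonneg _).trans (hM x hx)
    have hGx : G x = 0 := by
      rw [← norm_eq_zero, ← norm_iteratedFDeriv_zero (𝕜 := ℝ), h0 0 (by omega), norm_zero]
    have hseg : segment ℝ x y ⊆ s := hs.segment_subset hx hy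
    have := (convex_segment x y).norm_image_sub_le_of_norm_fderiv_le (𝕜 := ℝ) (f := G)
      (C := M * ‖y - x‖ ^ k)
      (fun z hz ↦ (hG z (hseg hz)).differentiableAt (by simp))
      (fun z hz ↦ (hd z (hseg hz)).trans (by
        gcongr
        exact norm_sub_le_of_mem_segment hz)) (left_mem_segment ℝ x y) (right_mem_segment ℝ x y)
    rw [hGx, sub_zero] at this
    rw [pow_succ, ← mul_assoc]
    exact this

theorem measure_image_null_of_locally_null {α β : Type*} [TopologicalSpace α]
    [SecondCountableTopology α] [MeasurableSpace β] {μ : Measure β} {f : α → β} {A : Set α}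
    (h : ∀ x ∈ A, ∃ U ∈ 𝓝 x, μ (f '' (U ∩ A)) = 0) : μ (f '' A) = 0 := by
  choose! U hU hμ using h
  obtain ⟨t, htA, htc, ht⟩ := TopologicalSpace.countable_cover_nhdsWithin
    (fun x hx ↦ mem_nhdsWithin_of_mem_nhds (hU x hx) : ∀ x ∈ A, U x ∈ 𝓝[A] x)
  refine measure_mono_null ?_ ((measure_biUnion_null_iff htc).2 fun x hx ↦ hμ x (htA hx))
  rintro _ ⟨a, ha, rfl⟩
  obtain ⟨x, hx, hax⟩ := mem_iUnion₂.1 (ht ha)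
  exact mem_iUnion₂.2 ⟨x, hx, a, ⟨hax, ha⟩, rfl⟩

/-- Points at which sufficiently many derivatives of a real function vanish have null image. -/
theorem volume_image_eq_zero_of_iteratedFDeriv_eq_zero {E : Type u} [NormedAddCommGroup E]
    [NormedSpace ℝ E] [FiniteDimensional ℝ E] {f : E → ℝ} {A : Set E}
    (hf : ∀ x ∈ A, ∀ᶠ z in 𝓝 x, ContDiffAt ℝ ∞ f z)
    (h0 : ∀ x ∈ A, ∀ i, 1 ≤ i → i ≤ finrank ℝ E → iteratedFDeriv ℝ i f x = 0) :
    volume (f '' A) = 0 := by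
  set n := finrank ℝ E with hn
  -- Hölder exponent `n + 1` on a subset of an `n`-dimensional space gives an image of dimension at
  -- most `n / (n + 1) < 1`.
  have hH : ∀ x ∈ A, ∃ C : NNReal, ∃ t ∈ 𝓝[A] x, HolderOnWith C (n + 1 : NNReal) f t := by
    intro x hx
    have hcont : ContinuousAt (iteratedFDeriv ℝ (n + 1) f) x :=
      (hf x hx).self_of_nhds.continuousAt_iteratedFDeriv (by exact_mod_cast le_top)
    have hb : ∀ᶠ z in 𝓝 x, ‖iteratedFDeriv ℝ (n + 1) f z‖ ≤
        ‖iteratedFDeriv ℝ (n + 1) f x‖ + 1 :=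
      (hcont.norm.eventually (gt_mem_nhds (lt_add_one _))).mono fun z hz ↦ le_of_lt hz
    obtain ⟨r, hr, hball⟩ := Metric.eventually_nhds_iff_ball.1 ((hf x hx).and hb)
    set M : ℝ := ‖iteratedFDeriv ℝ (n + 1) f x‖ + 1
    have hM0 : 0 ≤ M := by positivity
    refine ⟨M.toNNReal, A ∩ Metric.ball x r,
      inter_mem_nhdsWithin _ (Metric.ball_mem_nhds x hr), ?_⟩
    have key : ∀ a ∈ A ∩ Metric.ball x r, ∀ b ∈ Metric.ball x r,
        ‖f b - f a‖ ≤ M * ‖b - a‖ ^ (n + 1) := by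
      rintro a ⟨haA, har⟩ b hb
      -- The Taylor estimate is applied to the derivative because `f a` need not vanish; the mean
      -- value inequality supplies the last power.
      have hd : ∀ z ∈ Metric.ball x r, ‖fderiv ℝ f z‖ ≤ M * ‖z - a‖ ^ n := by
        intro z hz
        refine norm_le_mul_pow_of_iteratedFDeriv_eq_zero n (convex_ball x r)
          (fun z hz ↦ (hball z hz).1.fderiv_right (by exact_mod_cast le_top)) (fun z hz ↦ ?_) har
          (fun i hi ↦ ?_) hz
        · rw [norm_iteratedFDeriv_fderiv]; exact (hball z hz).2
        · rw [← norm_eq_zero, norm_iteratedFDeriv_fderiv, h0 a haA _ (by omega) (by omega),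
            norm_zero]
      have hseg : segment ℝ a b ⊆ Metric.ball x r := (convex_ball x r).segment_subset har hb
      have := (convex_segment a b).norm_image_sub_le_of_norm_fderiv_le (𝕜 := ℝ) (f := f)
        (C := M * ‖b - a‖ ^ n)
        (fun z hz ↦ (hball z (hseg hz)).1.differentiableAt (by simp))
        (fun z hz ↦ (hd z (hseg hz)).trans (by
          gcongr
          exact norm_sub_le_of_mem_segment hz)) (left_mem_segment ℝ a b) (right_mem_segment ℝ a b)
      rw [pow_succ, ← mul_assoc]
      exact this
    intro a ha b hb
    have h := key b hb a ha.2
    rw [← Nat.cast_succ, NNReal.coe_natCast, ENNReal.rpow_natCast, edist_nndist, edist_nndist,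
      ← ENNReal.coe_pow, ← ENNReal.coe_mul, ENNReal.coe_le_coe, ← NNReal.coe_le_coe]
    simpa [dist_eq_norm, Real.coe_toNNReal M hM0] using h
  have hdim : dimH (f '' A) < 1 := by
    refine (dimH_image_le_of_locally_holder_on (by positivity) hH).trans_lt ?_
    refine ENNReal.div_lt_of_lt_mul ?_
    refine (dimH_mono (subset_univ A)).trans_lt ?_
    rw [Real.dimH_univ_eq_finrank, one_mul, ← hn]
    exact_mod_cast Nat.lt_succ_self n
  have := hausdorffMeasure_of_dimH_lt (d := 1) (by simpa using hdim)
  rwa [NNReal.coe_one, hausdorffMeasure_real] at this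

/-- The Morse–Sard theorem for real functions: a set of critical points of a smooth function on
a finite-dimensional space has null image. -/
theorem volume_image_eq_zero_of_fderiv_eq_zero (n : ℕ) {E : Type u} [NormedAddCommGroup E]
    [NormedSpace ℝ E] [FiniteDimensional ℝ E] (hn : finrank ℝ E = n) {f : E → ℝ} {A : Set E}
    (hf : ∀ x ∈ A, ∀ᶠ z in 𝓝 x, ContDiffAt ℝ ∞ f z) (h0 : ∀ x ∈ A, fderiv ℝ f x = 0) :
    volume (f '' A) = 0 := by
  induction n using Nat.strong_induction_on generalizing E with
  | _ n ih =>
  -- Critical points are sorted by the order at which derivatives stop vanishing; `Z` collects those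
  -- where they never do.
  set A' : ℕ → Set E := fun i ↦
    {x ∈ A | iteratedFDeriv ℝ i f x = 0 ∧ iteratedFDeriv ℝ (i + 1) f x ≠ 0}
  set Z : Set E := {x ∈ A | ∀ i, 1 ≤ i → iteratedFDeriv ℝ i f x = 0}
  have hcover : A ⊆ Z ∪ ⋃ i, A' i := by
    intro x hx
    by_cases hZ : ∀ i, 1 ≤ i → iteratedFDeriv ℝ i f x = 0
    · exact Or.inl ⟨hx, hZ⟩
    refine Or.inr (mem_iUnion.2 ?_)
    by_contra! hcon
    refine hZ fun i hi ↦ ?_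
    induction i, hi using Nat.le_induction with
    | base => rw [← norm_eq_zero, norm_iteratedFDeriv_one, h0 x hx, norm_zero]
    | succ i hi ihi =>
      by_contra hne
      exact hcon i ⟨hx, ihi, hne⟩
  have hA' : ∀ i, volume (f '' A' i) = 0 := by
    intro i
    refine measure_image_null_of_locally_null fun x hx ↦ ?_
    obtain ⟨hxA, hx0, hx1⟩ := hx
    obtain ⟨m, hm⟩ : ∃ m, iteratedFDeriv ℝ (i + 1) f x m ≠ 0 := by
      by_contra! hcon
      exact hx1 (ContinuousMultilinearMap.ext hcon)
    -- This component of the `i`-th derivative vanishes on `A' i` but has nonzero differential at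
    -- `x`. Locally `A' i` thus lies in the hypersurface `w = 0`, and induction applies to `f`
    -- restricted there.
    set w : E → ℝ := fun z ↦ iteratedFDeriv ℝ i f z (Fin.tail m) with hw
    have hDi : ∀ᶠ z in 𝓝 x, ContDiffAt ℝ ∞ (iteratedFDeriv ℝ i f) z := by
      filter_upwards [hf x hxA] with z hz
      exact hz.iteratedFDeriv_right (by exact_mod_cast le_top)
    have hwsm : ∀ᶠ z in 𝓝 x, ContDiffAt ℝ ∞ w z := by
      filter_upwards [hDi] with z hz
      exact (ContinuousMultilinearMap.apply ℝ (fun _ : Fin i ↦ E) ℝ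
        (Fin.tail m)).contDiff.contDiffAt.comp z hz
    have hwd : fderiv ℝ w x (m 0) ≠ 0 := by
      have : HasFDerivAt w _ x := (ContinuousMultilinearMap.apply ℝ (fun _ : Fin i ↦ E) ℝ
        (Fin.tail m)).hasFDerivAt.comp x
          (hDi.self_of_nhds.differentiableAt (by simp)).hasFDerivAt
      rw [this.fderiv]
      rwa [iteratedFDeriv_succ_apply_left] at hm
    have hrange : (fderiv ℝ w x).range = ⊤ := by
      refine LinearMap.range_eq_top.2 (LinearMap.surjective ?_)
      intro h
      exact hwd (DFunLike.congr_fun h (m 0))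
    have hfin : finrank ℝ (fderiv ℝ w x).ker < n := by
      have := LinearMap.finrank_range_add_finrank_ker (fderiv ℝ w x).toLinearMap
      rw [hrange, finrank_top, finrank_self, hn] at this
      omega
    have := FiniteDimensional.complete ℝ E
    obtain ⟨ψ, hxψ, hfst, hψ, hψs⟩ := exists_straightening hwsm hrange
      (Submodule.ClosedComplemented.of_finiteDimensional _)
    refine ⟨ψ.source, ψ.open_source.mem_nhds hxψ, ?_⟩
    set θ : (fderiv ℝ w x).ker → E := fun k ↦ ψ.symm (0, k) with hθ
    set B : Set (fderiv ℝ w x).ker := {k | (0, k) ∈ ψ.target ∧ θ k ∈ A}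
    have hθs : ∀ k, (0, k) ∈ ψ.target → ContDiffAt ℝ ∞ θ k := fun k hk ↦
      (hψs _ hk).comp k (contDiff_prodMk_right (0 : ℝ)).contDiffAt
    refine measure_mono_null ?_ (ih _ hfin rfl (f := f ∘ θ) (A := B) ?_ ?_)
    · rintro _ ⟨z, ⟨hzs, hzA⟩, rfl⟩
      have hwz : w z = 0 := by simp [hw, hzA.2.1]
      have hz : ψ z = (0, (ψ z).2) := by rw [← hwz, ← hfst]
      have hθz : θ (ψ z).2 = z := by rw [hθ]; simp only; rw [← hz, ψ.left_inv hzs]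
      refine ⟨(ψ z).2, ⟨?_, ?_⟩, ?_⟩
      · rw [← hz]; exact ψ.map_source hzs
      · rw [hθz]; exact hzA.1
      · rw [Function.comp_apply, hθz]
    · rintro k ⟨hk, hkA⟩
      have hline : Continuous fun k : (fderiv ℝ w x).ker ↦ ((0 : ℝ), k) := by fun_prop
      filter_upwards [hline.continuousAt.eventually (ψ.open_target.mem_nhds hk),
        (hθs k hk).continuousAt.eventually (hf _ hkA)] with k' hk' hk''
      exact hk''.comp k' (hθs k' hk')
    · rintro k ⟨hk, hkA⟩
      rw [fderiv_comp k ((hf _ hkA).self_of_nhds.differentiableAt (by simp))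
        ((hθs k hk).differentiableAt (by simp)), h0 _ hkA, ContinuousLinearMap.zero_comp]
  refine measure_mono_null (image_mono hcover) ?_
  rw [image_union, image_iUnion]
  refine measure_union_null ?_ (measure_iUnion_null hA')
  exact volume_image_eq_zero_of_iteratedFDeriv_eq_zero (fun x hx ↦ hf x hx.1)
    fun x hx i hi _ ↦ hx.2 i hi

end ScalarSard

/-! ### Morse–Sard between finite-dimensional spaces. -/

section Sard

universe u v

/-- Surjectivity is stable under small perturbations for operators with complemented kernel. -/
theorem ContinuousLinearMap.eventually_surjective {E F : Type*} [NormedAddCommGroup E]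
    [NormedSpace ℝ E] [CompleteSpace E] [NormedAddCommGroup F] [NormedSpace ℝ F] [CompleteSpace F]
    {T : E →L[ℝ] F} (hT : Function.Surjective T) (hker : T.ker.ClosedComplemented) :
    ∀ᶠ S in 𝓝 T, Function.Surjective (S : E →L[ℝ] F) := by
  obtain ⟨P, hP⟩ := hker
  let e : E ≃L[ℝ] F × T.ker := T.equivProdOfSurjectiveOfIsCompl P
    (LinearMap.range_eq_top.2 hT) (LinearMap.range_eq_of_proj hP) (LinearMap.isCompl_of_proj hP)
  -- A right inverse of `T`: for `S` near `T`, `S ∘ B` stays invertible, which forces `S` to be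
  -- onto.
  let B : F →L[ℝ] E := (e.symm : F × T.ker →L[ℝ] E).comp (ContinuousLinearMap.inl ℝ F T.ker)
  have hTB : T.comp B = ((ContinuousLinearEquiv.refl ℝ F : F ≃L[ℝ] F) : F →L[ℝ] F) := by
    ext y
    exact congrArg Prod.fst (e.apply_symm_apply (y, 0))
  have hcont : Continuous fun S : E →L[ℝ] F ↦ S.comp B := by fun_prop
  have hmem : range ((↑) : (F ≃L[ℝ] F) → F →L[ℝ] F) ∈ 𝓝 (T.comp B) :=
    ContinuousLinearEquiv.isOpen.mem_nhds ⟨_, hTB.symm⟩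
  filter_upwards [hcont.continuousAt.eventually hmem] with S hS
  obtain ⟨e', he'⟩ := hS
  intro y
  obtain ⟨z, hz⟩ := e'.surjective y
  exact ⟨B z, by rw [← hz, ← ContinuousLinearMap.comp_apply, ← he']; rfl⟩

/-- Surjectivity is open at operators with complemented kernel. This yields measurable critical
images for Fubini and closed ones in the Fredholm case. -/
theorem isClosed_inter_setOf_not_surjective {X E F : Type*} [TopologicalSpace X]
    [NormedAddCommGroup E] [NormedSpace ℝ E] [CompleteSpace E]
    [NormedAddCommGroup F] [NormedSpace ℝ F] [CompleteSpace F]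
    {T : X → E →L[ℝ] F} {s : Set X} (hs : IsClosed s) (hT : ∀ x ∈ s, ContinuousAt T x)
    (hker : ∀ x ∈ s, (T x).ker.ClosedComplemented) :
    IsClosed (s ∩ {x | ¬ Function.Surjective (T x)}) := by
  rw [← isOpen_compl_iff, isOpen_iff_mem_nhds]
  intro x hx
  by_cases hxs : x ∈ s
  · have hsurj : Function.Surjective (T x) := by
      by_contra h
      exact hx ⟨hxs, h⟩
    filter_upwards [(hT x hxs).eventually
      (ContinuousLinearMap.eventually_surjective hsurj (hker x hxs))] with z hz hz'
    exact hz'.2 hz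
  · filter_upwards [hs.isOpen_compl.mem_nhds hxs] with z hz hz'
    exact hz hz'.1

/-- The Morse–Sard theorem: a set of critical points of a smooth map between finite-dimensional
spaces has null image. -/
theorem addHaar_image_eq_zero_of_not_surjective_fderiv (p : ℕ) {E : Type u} {F : Type v}
    [NormedAddCommGroup E] [NormedSpace ℝ E] [FiniteDimensional ℝ E]
    [NormedAddCommGroup F] [NormedSpace ℝ F] [FiniteDimensional ℝ F] [MeasurableSpace F]
    [BorelSpace F] (μ : Measure F) [μ.IsAddHaarMeasure] (hp : finrank ℝ F = p)
    {f : E → F} {A : Set E} (hf : ∀ x ∈ A, ∀ᶠ z in 𝓝 x, ContDiffAt ℝ ∞ f z)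
    (hA : ∀ x ∈ A, ¬ Function.Surjective (fderiv ℝ f x)) : μ (f '' A) = 0 := by
  induction p using Nat.strong_induction_on generalizing E F with
  | _ p ih =>
  have := FiniteDimensional.complete ℝ E
  have := FiniteDimensional.complete ℝ F
  have := FiniteDimensional.proper_real E
  have := FiniteDimensional.proper_real F
  -- One nonzero functional suffices here: scalar Sard makes its values null, and preimages of null
  -- sets under a surjective linear map are null.
  have hzero : μ (f '' {x ∈ A | fderiv ℝ f x = 0}) = 0 := by
    rcases subsingleton_or_nontrivial F with hF | hF
    · refine measure_mono_null ?_ (measure_empty (μ := μ))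
      rintro _ ⟨x, ⟨hxA, -⟩, rfl⟩
      exact hA x hxA fun y ↦ ⟨0, Subsingleton.elim _ _⟩
    obtain ⟨v, hv⟩ := exists_ne (0 : F)
    obtain ⟨l, hl⟩ := SeparatingDual.exists_ne_zero (R := ℝ) hv
    have hlsurj : Function.Surjective l.toLinearMap :=
      LinearMap.surjective fun h ↦ hl (DFunLike.congr_fun h v)
    have hnull : volume ((fun x ↦ l (f x)) '' {x ∈ A | fderiv ℝ f x = 0}) = 0 := by
      refine volume_image_eq_zero_of_fderiv_eq_zero _ rfl (fun x hx ↦ ?_) fun x hx ↦ ?_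
      · filter_upwards [hf x hx.1] with z hz
        exact l.contDiff.contDiffAt.comp z hz
      · have : HasFDerivAt (fun x ↦ l (f x)) (l.comp (fderiv ℝ f x)) x := l.hasFDerivAt.comp x
          ((hf x hx.1).self_of_nhds.differentiableAt (by simp)).hasFDerivAt
        rw [this.fderiv, hx.2, ContinuousLinearMap.comp_zero]
    have hae := (ae_comp_linearMap_mem_iff l.toLinearMap μ volume hlsurj
      (measurableSet_toMeasurable volume
        ((fun x ↦ l (f x)) '' {x ∈ A | fderiv ℝ f x = 0})).compl).2
      (by rw [← measure_toMeasurable] at hnull; exact measure_eq_zero_iff_ae_notMem.1 hnull)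
    refine measure_mono_null ?_ (measure_eq_zero_iff_ae_notMem.2 hae)
    rintro _ ⟨x, hx, rfl⟩
    exact subset_toMeasurable _ _ ⟨x, hx, rfl⟩
  have hne : μ (f '' {x ∈ A | fderiv ℝ f x ≠ 0}) = 0 := by
    refine measure_image_null_of_locally_null fun x hx ↦ ?_
    obtain ⟨hxA, hx0⟩ := hx
    obtain ⟨v, hv⟩ : ∃ v, fderiv ℝ f x v ≠ 0 := by
      by_contra! hcon
      exact hx0 (ContinuousLinearMap.ext hcon)
    obtain ⟨l, hl⟩ := SeparatingDual.exists_ne_zero (R := ℝ) hv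
    have hWd : fderiv ℝ (fun z ↦ l (f z)) x = l.comp (fderiv ℝ f x) :=
      (l.hasFDerivAt.comp x
        ((hf x hxA).self_of_nhds.differentiableAt (by simp)).hasFDerivAt).fderiv
    have hrange : (fderiv ℝ (fun z ↦ l (f z)) x).range = ⊤ := by
      refine LinearMap.range_eq_top.2 (LinearMap.surjective fun h ↦ hl ?_)
      have := DFunLike.congr_fun h v
      rwa [hWd] at this
    have hlrange : l.range = ⊤ := LinearMap.range_eq_top.2
      (LinearMap.surjective fun h ↦ hl (DFunLike.congr_fun h (fderiv ℝ f x v)))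
    have hfin : finrank ℝ l.ker < p := by
      have := LinearMap.finrank_range_add_finrank_ker l.toLinearMap
      rw [hlrange, finrank_top, finrank_self, hp] at this
      omega
    obtain ⟨ψ', hxψ', hfst', -, hψs'⟩ := exists_straightening (W := fun z ↦ l (f z))
      ((hf x hxA).mono fun z hz ↦ l.contDiff.contDiffAt.comp z hz) hrange
      (Submodule.ClosedComplemented.of_finiteDimensional _)
    obtain ⟨S, hS, hSo, hxS⟩ := eventually_nhds_iff.1 (hf x hxA)
    set ψ := ψ'.restrOpen S hSo
    have hxψ : x ∈ ψ.source := ⟨hxψ', hxS⟩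
    obtain ⟨r, hr, hball⟩ := Metric.nhds_basis_closedBall.mem_iff.1 (ψ.open_source.mem_nhds hxψ)
    refine ⟨Metric.closedBall x r, Metric.closedBall_mem_nhds x hr, ?_⟩
    -- All critical points in the ball are taken, not only those in `A`, so that `f '' C` is compact
    -- and Fubini along `ker l` applies.
    set C : Set E := Metric.closedBall x r ∩ {x | ¬ Function.Surjective (fderiv ℝ f x)}
    have hCs : C ⊆ ψ.source := inter_subset_left.trans hball
    have hCcomp : IsCompact C := (isCompact_closedBall x r).of_isClosed_subset
      (isClosed_inter_setOf_not_surjective Metric.isClosed_closedBall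
        (fun z hz ↦ (hS z (hball hz).2).continuousAt_fderiv (by simp))
        fun z _ ↦ Submodule.ClosedComplemented.of_finiteDimensional _) inter_subset_left
    have hfC : IsCompact (f '' C) := hCcomp.image_of_continuousOn fun z hz ↦
      (hS z (hCs hz).2).continuousAt.continuousWithinAt
    have hnull : ∀ᵐ y ∂μ, y ∈ (f '' C)ᶜ := by
      refine ae_mem_of_ae_add_linearMap_mem l.ker.subtype Measure.addHaar μ
        hfC.measurableSet.compl fun y ↦ ?_
      obtain ⟨g, B, hg, hgB, hsub⟩ := exists_slice_criticalValues l
        (Submodule.ClosedComplemented.of_finiteDimensional _) ψ hfst'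
        (fun z hz ↦ hS z hz.2) (fun z hz ↦ hψs' z hz.1) hCs (fun z hz ↦ hz.2) y
      exact measure_eq_zero_iff_ae_notMem.1
        (measure_mono_null hsub (ih _ hfin Measure.addHaar rfl hg hgB))
    refine measure_mono_null (image_mono ?_) (measure_eq_zero_iff_ae_notMem.2 hnull)
    exact fun z hz ↦ ⟨hz.1, hA z hz.2.1⟩
  refine measure_mono_null ?_ (measure_union_null hzero hne)
  rw [← image_union]
  refine image_mono fun x hx ↦ ?_
  by_cases h : fderiv ℝ f x = 0
  · exact Or.inl ⟨hx, h⟩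
  · exact Or.inr ⟨hx, h⟩

end Sard

/-! ### Smale's local theorem. -/

section Fredholm

/-- Smale's local theorem: every point has a neighbourhood whose critical points
under a smooth Fredholm map have a closed image with empty interior. -/
theorem exists_nhds_isClosed_criticalValues {E F : Type*}
    [NormedAddCommGroup E] [NormedSpace ℝ E] [CompleteSpace E]
    [NormedAddCommGroup F] [NormedSpace ℝ F] [CompleteSpace F] {Φ : E → F} {x₀ : E}
    (hΦ : ∀ᶠ x in 𝓝 x₀, ContDiffAt ℝ ∞ Φ x)
    (hFred : ∀ᶠ x in 𝓝 x₀, (fderiv ℝ Φ x).IsFredholm) :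
    ∃ U ∈ 𝓝 x₀, IsClosed (Φ '' (U ∩ {x | ¬ Function.Surjective (fderiv ℝ Φ x)})) ∧
      interior (Φ '' (U ∩ {x | ¬ Function.Surjective (fderiv ℝ Φ x)})) = ∅ := by
  set T := fderiv ℝ Φ x₀ with hT
  have hTF : T.IsFredholm := hFred.self_of_nhds
  obtain ⟨π, hπ⟩ := hTF.closedComplemented_range
  have : CompleteSpace T.range := hTF.isClosed_range.completeSpace_coe
  have hN : FiniteDimensional ℝ π.ker := by
    have := hTF.finite_coker
    have : FiniteDimensional ℝ (F ⧸ T.range) := this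
    exact (Submodule.quotientEquivOfIsCompl _ _
      (LinearMap.isCompl_of_proj hπ)).finiteDimensional
  have hWd : fderiv ℝ (fun z ↦ π (Φ z)) x₀ = π.comp T :=
    (π.hasFDerivAt.comp x₀
      (hΦ.self_of_nhds.differentiableAt (by simp)).hasFDerivAt).fderiv
  have hπT : ∀ v, π (T v) = ⟨T v, v, rfl⟩ := fun v ↦ hπ ⟨T v, v, rfl⟩
  have hrange : (fderiv ℝ (fun z ↦ π (Φ z)) x₀).range = ⊤ := by
    rw [hWd]
    refine LinearMap.range_eq_top.2 ?_
    rintro ⟨_, v, rfl⟩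
    exact ⟨v, hπT v⟩
  have hker : (fderiv ℝ (fun z ↦ π (Φ z)) x₀).ker = T.ker := by
    rw [hWd]
    ext v
    simp only [LinearMap.mem_ker, ContinuousLinearMap.coe_coe, ContinuousLinearMap.comp_apply, hπT]
    exact Subtype.ext_iff
  have hKcc : (fderiv ℝ (fun z ↦ π (Φ z)) x₀).ker.ClosedComplemented := by
    rw [hker]; exact hTF.closedComplemented_ker
  have hKfin : FiniteDimensional ℝ (fderiv ℝ (fun z ↦ π (Φ z)) x₀).ker := by
    rw [hker]; exact hTF.finite_ker
  have := FiniteDimensional.proper_real (fderiv ℝ (fun z ↦ π (Φ z)) x₀).ker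
  obtain ⟨ψ', hxψ', hfst, -, hψs'⟩ := exists_straightening (W := fun z ↦ π (Φ z))
    (hΦ.mono fun z hz ↦ π.contDiff.contDiffAt.comp z hz) hrange hKcc
  obtain ⟨S, hS, hSo, hxS⟩ := eventually_nhds_iff.1 (hΦ.and hFred)
  set ψ := ψ'.restrOpen S hSo
  have hxψ : x₀ ∈ ψ.source := ⟨hxψ', hxS⟩
  have hfstψ : ∀ x, (ψ x).1 = π (Φ x) := hfst
  obtain ⟨r, hr, hball⟩ := Metric.nhds_basis_closedBall.mem_iff.1
    (ψ.open_target.mem_nhds (ψ.map_source hxψ))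
  set D := Metric.closedBall (ψ x₀) r with hD
  have hmemS : ∀ z ∈ D, ψ.symm z ∈ S := fun z hz ↦ (ψ.map_target (hball hz)).2
  have hcs : ∀ z ∈ D, ContinuousAt ψ.symm z := fun z hz ↦
    ψ.symm.continuousAt (hball hz)
  set Crit : Set E := {x | ¬ Function.Surjective (fderiv ℝ Φ x)} with hCrit
  set Q : Set (T.range × _) := D ∩ {z | ¬ Function.Surjective (fderiv ℝ Φ (ψ.symm z))} with hQ
  have hQcl : IsClosed Q := isClosed_inter_setOf_not_surjective Metric.isClosed_closedBall
    (fun z hz ↦ ((hS _ (hmemS z hz)).1.continuousAt_fderiv (by simp)).comp (hcs z hz))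
    fun z hz ↦ (hS _ (hmemS z hz)).2.closedComplemented_ker
  have himg : Φ '' (ψ.symm '' D ∩ Crit) = (fun z ↦ Φ (ψ.symm z)) '' Q := by
    ext y
    constructor
    · rintro ⟨_, ⟨⟨z, hz, rfl⟩, hzc⟩, rfl⟩
      exact ⟨z, ⟨hz, hzc⟩, rfl⟩
    · rintro ⟨z, ⟨hz, hzc⟩, rfl⟩
      exact ⟨_, ⟨⟨z, hz, rfl⟩, hzc⟩, rfl⟩
  refine ⟨ψ.symm '' D, ?_, ?_, ?_⟩
  · have := ψ.symm.image_mem_nhds (ψ.map_source hxψ)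
      (Metric.closedBall_mem_nhds (ψ x₀) hr)
    rwa [ψ.left_inv hxψ] at this
  · rw [himg]
    -- Local properness: first coordinates of preimages are `π (y n)`, hence converge, while second
    -- coordinates lie in a compact ball.
    refine IsSeqClosed.isClosed fun y b hy hb ↦ ?_
    choose z hzQ hzy using hy
    have hz1 : ∀ n, (z n).1 = π (y n) := fun n ↦ by
      rw [← hzy, ← hfstψ, ψ.right_inv (hball (hzQ n).1)]
    have hz2 : ∀ n, (z n).2 ∈ Metric.closedBall (ψ x₀).2 r := fun n ↦ by
      have := (hzQ n).1
      rw [hD, ← Prod.mk.eta (p := ψ x₀), ← closedBall_prod_same] at this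
      exact this.2
    obtain ⟨k, -, φ, hφ, hk⟩ := (isCompact_closedBall (ψ x₀).2 r).tendsto_subseq hz2
    have hlim : Tendsto (z ∘ φ) atTop (𝓝 (π b, k)) := by
      have h1 : Tendsto (fun n ↦ (z (φ n)).1) atTop (𝓝 (π b)) := by
        simp_rw [hz1]
        exact (π.continuous.tendsto b).comp (hb.comp hφ.tendsto_atTop)
      exact h1.prodMk_nhds hk
    have hmem : (π b, k) ∈ Q := hQcl.mem_of_tendsto hlim (Eventually.of_forall fun n ↦ hzQ _)
    refine ⟨_, hmem, ?_⟩
    have hG : ContinuousAt (fun z ↦ Φ (ψ.symm z)) (π b, k) :=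
      ContinuousAt.comp (hS _ (hmemS _ hmem.1)).1.continuousAt (hcs _ hmem.1)
    refine tendsto_nhds_unique (hG.tendsto.comp hlim) ?_
    refine (hb.comp hφ.tendsto_atTop).congr fun n ↦ (hzy (φ n)).symm
  · let _ : MeasurableSpace π.ker := borel _
    have : BorelSpace π.ker := ⟨rfl⟩
    have hCs : ψ.symm '' D ∩ Crit ⊆ ψ.source := by
      rintro _ ⟨⟨z, hz, rfl⟩, -⟩
      exact ψ.map_target (hball hz)
    rw [eq_empty_iff_forall_notMem]
    intro y hy
    obtain ⟨g, B, hg, hgB, hsub⟩ := exists_slice_criticalValues π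
      (Submodule.ClosedComplemented.of_finiteDimensional _) ψ hfstψ
      (fun z hz ↦ (hS z hz.2).1) (fun z hz ↦ hψs' z hz.1) hCs (fun z hz ↦ hz.2) y
    have hnull := measure_mono_null hsub
      (addHaar_image_eq_zero_of_not_surjective_fderiv _ (Measure.addHaar (G := π.ker)) rfl hg hgB)
    have hempty := Measure.interior_eq_empty_of_null hnull
    -- An interior point `y` would make the slice through `y` a neighbourhood of `0`, contradicting
    -- nullity; no Fubini is needed.
    have hcont : Continuous fun n : π.ker ↦ y + (n : F) := by fun_prop
    have h0 : (0 : π.ker) ∈ interior {n : π.ker | y + (n : F) ∈ Φ '' (ψ.symm '' D ∩ Crit)} := by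
      rw [mem_interior_iff_mem_nhds]
      refine hcont.continuousAt.preimage_mem_nhds ?_
      simpa using mem_interior_iff_mem_nhds.1 hy
    rw [hempty] at h0
    exact h0

end Fredholm

/-! ### Nowhere dense sets and proper maps. -/

section NowhereDense

theorem IsNowhereDense.union {Y : Type*} [TopologicalSpace Y] {s t : Set Y}
    (hs : IsNowhereDense s) (ht : IsNowhereDense t) : IsNowhereDense (s ∪ t) := by
  rw [IsNowhereDense, closure_union, interior_union_isClosed_of_interior_empty isClosed_closure ht]
  exact hs

theorem isNowhereDense_biUnion_finset {Y ι : Type*} [TopologicalSpace Y] (t : Finset ι)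
    {s : ι → Set Y} (h : ∀ i ∈ t, IsNowhereDense (s i)) : IsNowhereDense (⋃ i ∈ t, s i) := by
  classical
  induction t using Finset.induction_on with
  | empty => simp
  | insert a t _ ih =>
    rw [Finset.set_biUnion_insert]
    exact (h a (Finset.mem_insert_self a t)).union
      (ih fun i hi ↦ h i (Finset.mem_insert_of_mem hi))

theorem isNowhereDense_of_locally {Y : Type*} [TopologicalSpace Y] {s : Set Y}
    (h : ∀ y, ∃ V, IsOpen V ∧ y ∈ V ∧ IsNowhereDense (V ∩ s)) : IsNowhereDense s := by
  rw [IsNowhereDense, eq_empty_iff_forall_notMem]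
  intro y hy
  obtain ⟨V, hV, hyV, hd⟩ := h y
  have : y ∈ interior (closure (V ∩ s)) :=
    mem_interior.2 ⟨V ∩ interior (closure s),
      (inter_subset_inter_right V interior_subset).trans hV.inter_closure,
      hV.inter isOpen_interior, hyV, hy⟩
  rw [hd] at this
  exact this

/-- The pulled-back set is closed only relative to the chart domain; this suffices, since a point of
the set interior to its closure would map to an interior point of `S`. -/
theorem OpenPartialHomeomorph.isNowhereDense_source_inter_preimage {Y F : Type*}
    [TopologicalSpace Y] [TopologicalSpace F] (e : OpenPartialHomeomorph Y F) {S : Set F}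
    (hS : IsClosed S) (hempty : interior S = ∅) : IsNowhereDense (e.source ∩ e ⁻¹' S) := by
  rw [isNowhereDense_iff_disjoint, disjoint_left]
  rintro y ⟨hye, hyS⟩ hy
  set W := e.source ∩ interior (closure (e.source ∩ e ⁻¹' S)) with hW
  have hWo : IsOpen W := e.open_source.inter isOpen_interior
  have hWS : e '' W ⊆ S := by
    rintro _ ⟨z, ⟨hze, hz⟩, rfl⟩
    by_contra hzS
    have ho : IsOpen (e.source ∩ e ⁻¹' Sᶜ) := e.isOpen_inter_preimage hS.isOpen_compl
    obtain ⟨w, hw, hw'⟩ := mem_closure_iff.1 (interior_subset hz) _ ho ⟨hze, hzS⟩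
    exact hw.2 hw'.2
  have : e y ∈ interior S := mem_interior.2 ⟨e '' W, hWS,
    e.isOpen_image_of_subset_source hWo inter_subset_left, mem_image_of_mem e ⟨hye, hy⟩⟩
  rw [hempty] at this
  exact this

/-- If every point has a neighbourhood on which `C` has a nowhere dense image, then `C ∩ K` has
nowhere dense image for each `K` on which the map is proper. -/
theorem IsProperMap.isNowhereDense_image_inter {X Y : Type*} [TopologicalSpace X]
    [TopologicalSpace Y] {Φ : X → Y} {K C : Set X} (hK : IsProperMap (K.domRestrict Φ))
    (h : ∀ x, ∃ U ∈ 𝓝 x, IsNowhereDense (Φ '' (U ∩ C))) : IsNowhereDense (Φ '' (C ∩ K)) := by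
  refine isNowhereDense_of_locally fun y ↦ ?_
  choose U hU hd using h
  have hcomp : IsCompact (K.domRestrict Φ ⁻¹' {y}) := hK.isCompact_preimage isCompact_singleton
  obtain ⟨t, -, ht⟩ := (hcomp.image continuous_subtype_val).elim_nhds_subcover
    (fun x ↦ interior (U x)) fun x _ ↦ interior_mem_nhds.2 (hU x)
  set O : Set X := ⋃ x ∈ t, interior (U x)
  have hO : IsOpen O := isOpen_biUnion fun x _ ↦ isOpen_interior
  -- Off this closed set, every preimage lying in `K` belongs to `O`, hence to one of finitely many
  -- `U x`.
  have hcl : IsClosed (K.domRestrict Φ '' (Subtype.val ⁻¹' Oᶜ)) :=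
    hK.isClosedMap _ (hO.isClosed_compl.preimage continuous_subtype_val)
  refine ⟨_, hcl.isOpen_compl, ?_, ?_⟩
  · rintro ⟨x, hxO, hxy⟩
    exact hxO (ht ⟨x, hxy, rfl⟩)
  · refine (isNowhereDense_biUnion_finset t fun x _ ↦ hd x).mono ?_
    rintro _ ⟨hV, x, ⟨hxC, hxK⟩, rfl⟩
    have hxO : x ∈ O := by
      by_contra hxO
      exact hV ⟨⟨x, hxK⟩, hxO, rfl⟩
    obtain ⟨i, hi, hxi⟩ := mem_iUnion₂.1 hxO
    exact mem_iUnion₂.2 ⟨i, hi, x, ⟨interior_subset hxi, hxC⟩, rfl⟩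

end NowhereDense

/-! ### Transfer to manifolds through charts. -/

section Manifold

theorem ContinuousLinearMap.IsFredholm.equiv_comp_comp_equiv {E E' F F' : Type*}
    [NormedAddCommGroup E] [NormedSpace ℝ E] [NormedAddCommGroup F] [NormedSpace ℝ F]
    [NormedAddCommGroup E'] [NormedSpace ℝ E'] [NormedAddCommGroup F'] [NormedSpace ℝ F']
    {T : E →L[ℝ] F} (hT : T.IsFredholm) (a : E' ≃L[ℝ] E) (b : F ≃L[ℝ] F') :
    ((b : F →L[ℝ] F').comp (T.comp (a : E' →L[ℝ] E))).IsFredholm := by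
  obtain ⟨S, hS⟩ := hT.exists_isQuasiInverse
  exact .of_isQuasiInverse (v := ((a.symm : E →L[ℝ] E').comp S).comp (b.symm : F' →L[ℝ] F))
    ((a.toLinearEquiv.isQuasiInverse.comp hS).comp b.toLinearEquiv.isQuasiInverse)

variable {E F : Type*} [NormedAddCommGroup E] [NormedSpace ℝ E]
  [NormedAddCommGroup F] [NormedSpace ℝ F]
  {X Y : Type*} [TopologicalSpace X] [ChartedSpace E X] [IsManifold 𝓘(ℝ, E) ∞ X]
  [TopologicalSpace Y] [ChartedSpace F Y] [IsManifold 𝓘(ℝ, F) ∞ Y]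

theorem contDiffAt_extChartAt_comp {Φ : X → Y} (hΦ : ContMDiff 𝓘(ℝ, E) 𝓘(ℝ, F) ∞ Φ) (x₀ : X)
    (y₀ : Y) {x : X} (hx : x ∈ (chartAt E x₀).source) (hy : Φ x ∈ (chartAt F y₀).source) :
    ContDiffAt ℝ ∞ (extChartAt 𝓘(ℝ, F) y₀ ∘ Φ ∘ (extChartAt 𝓘(ℝ, E) x₀).symm)
      (extChartAt 𝓘(ℝ, E) x₀ x) := by
  have hx' : x ∈ (extChartAt 𝓘(ℝ, E) x₀).source := by rwa [extChartAt_source]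
  have hinv := (extChartAt 𝓘(ℝ, E) x₀).left_inv hx'
  have h1 : ContMDiffAt 𝓘(ℝ, E) 𝓘(ℝ, E) ∞ (extChartAt 𝓘(ℝ, E) x₀).symm
      (extChartAt 𝓘(ℝ, E) x₀ x) :=
    (contMDiffOn_extChartAt_symm x₀).contMDiffAt
      ((isOpen_extChartAt_target x₀).mem_nhds ((extChartAt 𝓘(ℝ, E) x₀).map_source hx'))
  have h2 : ContMDiffAt 𝓘(ℝ, F) 𝓘(ℝ, F) ∞ (extChartAt 𝓘(ℝ, F) y₀)
      (Φ ((extChartAt 𝓘(ℝ, E) x₀).symm (extChartAt 𝓘(ℝ, E) x₀ x))) := by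
    rw [hinv]
    exact contMDiffAt_extChartAt' hy
  exact (h2.comp (extChartAt 𝓘(ℝ, E) x₀ x)
    (hΦ.contMDiffAt.comp (extChartAt 𝓘(ℝ, E) x₀ x) h1)).contDiffAt

/-- By the chain rule and invertibility of chart derivatives; Fredholmness and surjectivity can
therefore be tested in charts. -/
theorem exists_fderiv_extChartAt_comp_eq {Φ : X → Y} (hΦ : ContMDiff 𝓘(ℝ, E) 𝓘(ℝ, F) ∞ Φ)
    (x₀ : X) (y₀ : Y) {x : X} (hx : x ∈ (chartAt E x₀).source)
    (hy : Φ x ∈ (chartAt F y₀).source) :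
    ∃ (a : E ≃L[ℝ] E) (b : F ≃L[ℝ] F),
      fderiv ℝ (extChartAt 𝓘(ℝ, F) y₀ ∘ Φ ∘ (extChartAt 𝓘(ℝ, E) x₀).symm)
        (extChartAt 𝓘(ℝ, E) x₀ x) =
      (b : F →L[ℝ] F).comp ((mfderiv 𝓘(ℝ, E) 𝓘(ℝ, F) Φ x : E →L[ℝ] F).comp (a : E →L[ℝ] E)) := by
  have hx' : x ∈ (extChartAt 𝓘(ℝ, E) x₀).source := by rwa [extChartAt_source]
  have hy' : Φ x ∈ (extChartAt 𝓘(ℝ, F) y₀).source := by rwa [extChartAt_source]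
  have hinv := (extChartAt 𝓘(ℝ, E) x₀).left_inv hx'
  have : IsManifold 𝓘(ℝ, E) 1 X := .of_le (n := ∞) (by simp)
  have : IsManifold 𝓘(ℝ, F) 1 Y := .of_le (n := ∞) (by simp)
  have h1 : MDifferentiableAt 𝓘(ℝ, E) 𝓘(ℝ, E) (extChartAt 𝓘(ℝ, E) x₀).symm
      (extChartAt 𝓘(ℝ, E) x₀ x) :=
    ((contMDiffOn_extChartAt_symm (n := ∞) x₀).contMDiffAt
      ((isOpen_extChartAt_target x₀).mem_nhds
        ((extChartAt 𝓘(ℝ, E) x₀).map_source hx'))).mdifferentiableAt (by simp)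
  have h2 : MDifferentiableAt 𝓘(ℝ, F) 𝓘(ℝ, F) (extChartAt 𝓘(ℝ, F) y₀) (Φ x) :=
    (contMDiffAt_extChartAt' (n := ∞) hy).mdifferentiableAt (by simp)
  have h3 : MDifferentiableAt 𝓘(ℝ, E) 𝓘(ℝ, F) Φ x := hΦ.mdifferentiable (by simp) x
  obtain ⟨(b : F ≃L[ℝ] F), hb⟩ := isInvertible_mfderiv_extChartAt hy'
  have ha' := isInvertible_mfderivWithin_extChartAt_symm
    ((extChartAt 𝓘(ℝ, E) x₀).map_source hx')
  rw [ModelWithCorners.range_eq_univ, mfderivWithin_univ] at ha'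
  obtain ⟨(a : E ≃L[ℝ] E), ha⟩ := ha'
  have hd1 := h1.hasMFDerivAt
  rw [← ha] at hd1
  have hd2 := h2.hasMFDerivAt
  rw [← hb] at hd2
  have hd3 := h3.hasMFDerivAt
  have hc1 : HasMFDerivAt 𝓘(ℝ, E) 𝓘(ℝ, F) (Φ ∘ (extChartAt 𝓘(ℝ, E) x₀).symm)
      (extChartAt 𝓘(ℝ, E) x₀ x)
      ((mfderiv 𝓘(ℝ, E) 𝓘(ℝ, F) Φ x : E →L[ℝ] F).comp (a : E →L[ℝ] E)) := by
    refine HasMFDerivAt.comp _ ?_ hd1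
    rw [hinv]; exact hd3
  have hc2 : HasMFDerivAt 𝓘(ℝ, E) 𝓘(ℝ, F)
      (extChartAt 𝓘(ℝ, F) y₀ ∘ (Φ ∘ (extChartAt 𝓘(ℝ, E) x₀).symm))
      (extChartAt 𝓘(ℝ, E) x₀ x) ((b : F →L[ℝ] F).comp
        ((mfderiv 𝓘(ℝ, E) 𝓘(ℝ, F) Φ x : E →L[ℝ] F).comp (a : E →L[ℝ] E))) := by
    refine HasMFDerivAt.comp _ ?_ hc1
    rw [Function.comp_apply, hinv]; exact hd2
  refine ⟨a, b, HasFDerivAt.fderiv ?_⟩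
  exact hasMFDerivAt_iff_hasFDerivAt.1 hc2

theorem IsSmoothFredholmMap.exists_nhds_isNowhereDense_criticalValues [CompleteSpace E]
    [CompleteSpace F] {Φ : X → Y} (hΦ : IsSmoothFredholmMap E F Φ) (x₀ : X) :
    ∃ U ∈ 𝓝 x₀, IsNowhereDense
      (Φ '' (U ∩ {x | ¬ Function.Surjective (mfderiv 𝓘(ℝ, E) 𝓘(ℝ, F) Φ x)})) := by
  set Ψ : E → F := extChartAt 𝓘(ℝ, F) (Φ x₀) ∘ Φ ∘ (extChartAt 𝓘(ℝ, E) x₀).symm with hΨ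
  set O : Set X := (chartAt E x₀).source ∩ Φ ⁻¹' (chartAt F (Φ x₀)).source with hO
  have hOo : IsOpen O := (chartAt E x₀).open_source.inter
    ((chartAt F (Φ x₀)).open_source.preimage hΦ.contMDiff.continuous)
  have hxO : x₀ ∈ O := ⟨mem_chart_source E x₀, mem_chart_source F (Φ x₀)⟩
  have hev : ∀ᶠ z in 𝓝 (extChartAt 𝓘(ℝ, E) x₀ x₀), ∃ x ∈ O, extChartAt 𝓘(ℝ, E) x₀ x = z := by
    have := (chartAt E x₀).image_mem_nhds (mem_chart_source E x₀) (hOo.mem_nhds hxO)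
    filter_upwards [this] with z hz
    exact hz
  obtain ⟨U, hU, hcl, hempty⟩ := exists_nhds_isClosed_criticalValues (Φ := Ψ)
    (x₀ := extChartAt 𝓘(ℝ, E) x₀ x₀)
    (hev.mono (by
      rintro _ ⟨x, hx, rfl⟩
      exact contDiffAt_extChartAt_comp hΦ.contMDiff x₀ _ hx.1 hx.2))
    (hev.mono (by
      rintro _ ⟨x, hx, rfl⟩
      obtain ⟨a, b, hab⟩ := exists_fderiv_extChartAt_comp_eq hΦ.contMDiff x₀ _ hx.1 hx.2
      rw [hΨ, hab]
      exact ContinuousLinearMap.IsFredholm.equiv_comp_comp_equiv (E := E) (F := F)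
        (hΦ.isFredholm_mfderiv x) a b))
  refine ⟨O ∩ extChartAt 𝓘(ℝ, E) x₀ ⁻¹' U, inter_mem (hOo.mem_nhds hxO)
    ((continuousAt_extChartAt x₀).preimage_mem_nhds hU),
    ((chartAt F (Φ x₀)).isNowhereDense_source_inter_preimage hcl hempty).mono ?_⟩
  rintro _ ⟨x, ⟨⟨hxO', hxU⟩, hxc⟩, rfl⟩
  refine ⟨hxO'.2, extChartAt 𝓘(ℝ, E) x₀ x, ⟨hxU, fun hs ↦ hxc ?_⟩, ?_⟩
  · obtain ⟨a, b, hab⟩ := exists_fderiv_extChartAt_comp_eq hΦ.contMDiff x₀ _ hxO'.1 hxO'.2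
    rw [hΨ, hab] at hs
    intro w
    obtain ⟨v, hv⟩ := hs (b w)
    exact ⟨a v, b.injective hv⟩
  · rw [hΨ, Function.comp_apply, Function.comp_apply,
      (extChartAt 𝓘(ℝ, E) x₀).left_inv (by rw [extChartAt_source]; exact hxO'.1)]
    rfl

end Manifold

theorem mainTheorem3 {E F : Type*}
    [NormedAddCommGroup E] [NormedSpace ℝ E] [CompleteSpace E]
    [NormedAddCommGroup F] [NormedSpace ℝ F] [CompleteSpace F]
    {X Y : Type*}
    [TopologicalSpace X] [ChartedSpace E X] [IsManifold 𝓘(ℝ, E) ∞ X]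
    [TopologicalSpace Y] [ChartedSpace F Y] [IsManifold 𝓘(ℝ, F) ∞ Y]
    (Φ : X → Y) (hFredholm : IsSmoothFredholmMap E F Φ) (hParaproper : IsParaproper Φ) :
    regularValues E F Φ ∈ residual Y := by
  obtain ⟨K, hK, hKm⟩ := hParaproper.exists_exhaustion
  set C : Set X := {x | ¬ Function.Surjective (mfderiv 𝓘(ℝ, E) 𝓘(ℝ, F) Φ x)}
  have hmeagre : IsMeagre (⋃ m, Φ '' (C ∩ K m)) := isMeagre_iUnion fun m ↦
    ((hKm m).2.isNowhereDense_image_inter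
      hFredholm.exists_nhds_isNowhereDense_criticalValues).isMeagre
  -- `IsMeagre` unfolds to the complement being residual.
  refine mem_of_superset hmeagre ?_
  rintro _ hy x rfl
  by_contra hx
  obtain ⟨m, hm⟩ := mem_iUnion.1 (hK.symm ▸ mem_univ x : x ∈ ⋃ m, K m)
  exact hy (mem_iUnion.2 ⟨m, x, ⟨hx, hm⟩, rfl⟩)
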